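/- Let $\vec\xi=(\xi_1,\xi_2,\xi_3):\mathbb R^2\to\mathbb R^3$ be a centered Gaussian random field on a probability space $(\Omega,\mathcal F,P)$ whose coordinates are independent and identically distributed with covariance $E\,\xi_i(\vec u)\xi_i(\vec v)=e^{-\|\vec u-\vec v\|^2}$, taken in its modification with infinitely differentiable sample paths, and let $\vec\gamma(t)=\vec\xi(\cos t,\sin t)$, $t\in[0,2\pi]$, be the random closed curve that is the image of the unit circle. Call a $2\pi$-periodic $C^2$ map $\vec g:\mathbb R\to\mathbb R^3$ with $\vec g\,'(t)\neq 0$ for all $t$ that is injective on $[0,2\pi)$ a (parametrized) smooth knot, and say that two smooth knots have the same type if there is an ambient isotopy of $\mathbb R^3$ that carries the image of one onto the image of the other, that is, a continuous map $H:[0,1]\times\mathbb R^3\to\mathbb R^3$ such that every $H(s,\cdot)$ is a homeomorphism of $\mathbb R^3$, $H(0,\cdot)$ is the identity, and $H(1,\cdot)$ maps the first image onto the second. Then for every smooth knot $\vec f$ the set of $\omega\in\Omega$ such that $\vec\gamma(\cdot)(\omega)$ is a smooth knot of the same type as $\vec f$ is a random event (it belongs to $\mathcal F$) and has positive probability. In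 particular every type of smooth knot, trivial or nontrivial, occurs with positive probability. -/

import Mathlib

open MeasureTheory ProbabilityTheory
open scoped unitInterval

/-- The Euclidean plane. -/
abbrev Plane : Type := EuclideanSpace ℝ (Fin 2)

/-- Euclidean three-space. -/
abbrev Space : Type := EuclideanSpace ℝ (Fin 3)

/-- `ξ` is the centered Gaussian random field from the plane to three-space whose coordinates are
independent and identically distributed with covariance `exp (-‖u - v‖ ^ 2)`, in its modification
with infinitely differentiable sample paths. (The coordinates are identically distributed because
a Gaussian process is determined in law by its mean and its covariance.) -/
structure IsStationaryGaussianField {Ω : Type*} [MeasurableSpace Ω] (P : Measure Ω)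
    (ξ : Plane → Ω → Space) : Prop where
  measurable : ∀ u, Measurable (ξ u)
  gaussian : ∀ i : Fin 3, IsGaussianProcess (fun (u : Plane) (ω : Ω) => ξ u ω i) P
  centered : ∀ (i : Fin 3) (u : Plane), ∫ ω, ξ u ω i ∂P = 0
  covariance : ∀ (i : Fin 3) (u v : Plane),
    ∫ ω, ξ u ω i * ξ v ω i ∂P = Real.exp (-‖u - v‖ ^ 2)
  indep : iIndepFun (fun (i : Fin 3) (ω : Ω) (u : Plane) => ξ u ω i) P
  smooth : ∀ ω, ContDiff ℝ ((⊤ : ℕ∞) : WithTop ℕ∞) (fun u => ξ u ω)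

/-- The sample `t ↦ ξ (cos t, sin t)` of the random curve: the parametrized image of the unit
circle under the sample `ω` of the field. -/
noncomputable def randomCurve {Ω : Type*} (ξ : Plane → Ω → Space) (ω : Ω) : ℝ → Space :=
  fun t => ξ !₂[Real.cos t, Real.sin t] ω

/-- `f` parametrizes, with period `2π`, a smooth closed curve in space without
self-intersections: it is twice continuously differentiable and regular (as a closed curve, so the
two ends of a period fit together smoothly), and injective on a period. -/
structure IsSmoothKnot (f : ℝ → Space) : Prop where
  contDiff : ContDiff ℝ 2 f
  periodic : Function.Periodic f (2 * Real.pi)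
  regular : ∀ t, deriv f t ≠ 0
  injOn : Set.InjOn f (Set.Ico 0 (2 * Real.pi))

/-- Two subsets of space are ambient isotopic: a continuous family of homeomorphisms of space,
starting at the identity, ends with one that carries the first set onto the second. -/
def AmbientIsotopic (K L : Set Space) : Prop :=
  ∃ H : I → (Space ≃ₜ Space),
    Continuous (fun p : I × Space => H p.1 p.2) ∧ (∀ x, H 0 x = x) ∧ (H 1) '' K = L

/-- The curves parametrized by `f` and `g` are knots of the same type. -/
def SameKnotType (f g : ℝ → Space) : Prop :=
  IsSmoothKnot f ∧ IsSmoothKnot g ∧ AmbientIsotopic (Set.range f) (Set.range g)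

/-! Two facts carry the proof: knot types are stable under perturbations small in the Lipschitz
seminorm, and in that seminorm the random curve comes arbitrarily close to any periodic C¹ curve
with positive probability.

Stability (`IsSmoothKnot.exists_stable`): a knot is a bi-Lipschitz image of the circle, so a
displacement with small Lipschitz constant in the parameter is one with small Lipschitz constant on
the image. Extended to all of space with constant below 1, it is switched on linearly through
homeomorphisms.

Support (`IsStationaryGaussianField.pos_lipClose`): closed curves are separable for the seminorm, so
some ball around a sample g has positive probability. By Cameron–Martin, the law of each coordinate
may be shifted by covariance sections, which on the circle are multiples of exp(a cos t + b sin t).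
Their span is an algebra with cos and sin among its limits, hence all trigonometric polynomials,
hence, up to the Lipschitz seminorm, all periodic C¹ functions. Shifting by an approximation of g -
f carries the positive ball at g into a ball at f.

Measurability: by stability and separability, the event is a countable union of measurable balls. -/

/-! ### Cameron–Martin shifts along covariance sections -/

/-- The law of a Gaussian process is absolutely continuous with respect to its shift along a multiple
of the covariance section at a point of unit variance (a case of the Cameron–Martin theorem). -/
theorem map_absolutelyContinuous_shift {Ω T : Type*} [MeasurableSpace Ω] {P : Measure Ω}
    {X : T → Ω → ℝ} (hX : IsGaussianProcess X P) (mX : ∀ t, Measurable (X t)) (u : T)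
    (hu : Var[X u; P] = 1) (c : ℝ) :
    P.map (fun ω t => X t ω) ≪
      (P.map (fun ω t => X t ω)).map (fun y t => y t + c * cov[X u, X t; P]) := by
  have hP := hX.isProbabilityMeasure
  set k : T → ℝ := fun t => cov[X u, X t; P] with hk
  -- The regression residual of `X t` on `X u`: it is uncorrelated with `X u`, hence independent of
  -- it. Shifting `X` by `c * k` leaves `R` alone and translates `X u` by `c`, which reduces the
  -- claim to one dimension.
  set R : T → Ω → ℝ := fun t ω => X t ω - k t * X u ω with hR
  have mR : ∀ t, Measurable (R t) := fun t => (mX t).sub ((mX u).const_mul _)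
  have hL2 : ∀ t, MemLp (X t) 2 P := fun t => (hX.hasGaussianLaw_eval t).memLp_two
  have hind : IndepFun (fun ω (t : T) => R t ω) (fun ω (_ : Unit) => X u ω) P := by
    refine IsGaussianProcess.indepFun_of_covariance_eq_zero (X := R) (Y := fun _ : Unit => X u)
      ?_ (fun t => (mR t).aemeasurable) (fun _ => (mX u).aemeasurable) ?_
    · classical
      refine hX.of_isGaussianProcess ?_
      rintro (t | t)
      · refine ⟨{t, u}, ContinuousLinearMap.proj (R := ℝ) (φ := fun _ => ℝ) ⟨t, by simp⟩ -
          k t • ContinuousLinearMap.proj (R := ℝ) (φ := fun _ => ℝ) ⟨u, by simp⟩, fun ω => ?_⟩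
        simp [hR]
      · refine ⟨{u}, ContinuousLinearMap.proj (R := ℝ) (φ := fun _ => ℝ) ⟨u, by simp⟩, fun ω => ?_⟩
        simp
    · intro t _
      have h1 : R t = X t - k t • X u := rfl
      rw [h1, covariance_sub_left (hL2 t) ((hL2 u).const_smul _) (hL2 u),
        covariance_smul_left, covariance_self (mX u).aemeasurable, hu, covariance_comm]
      simp [hk]
  have mRf : Measurable (fun ω (t : T) => R t ω) := measurable_pi_lambda _ mR
  have hind' : IndepFun (fun ω (t : T) => R t ω) (X u) P :=
    hind.comp (φ := id) (ψ := fun y : Unit → ℝ => y ()) measurable_id (measurable_pi_apply _)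
  have hlaw := (indepFun_iff_map_prod_eq_prod_map_map mRf.aemeasurable
    (mX u).aemeasurable).1 hind'
  set F : (T → ℝ) × ℝ → (T → ℝ) := fun p t => p.1 t + k t * p.2 with hF
  have mF : Measurable F := by
    refine measurable_pi_lambda _ fun t => ?_
    exact ((measurable_pi_apply t).comp measurable_fst).add (measurable_snd.const_mul _)
  have mS : Measurable (fun (y : T → ℝ) t => y t + c * k t) :=
    measurable_pi_lambda _ fun t => (measurable_pi_apply t).add_const _
  have e1 : P.map (fun ω t => X t ω) = ((P.map fun ω t => R t ω).prod (P.map (X u))).map F := by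
    rw [← hlaw, Measure.map_map mF (mRf.prodMk (mX u))]
    congr 1
    ext ω t
    simp [hF, hR]
  have e2 : (P.map (fun ω t => X t ω)).map (fun y t => y t + c * k t) =
      ((P.map fun ω t => R t ω).prod ((P.map (X u)).map (· + c))).map F := by
    have : Measure.map (fun p : (T → ℝ) × ℝ => (p.1, p.2 + c))
        ((P.map fun ω t => R t ω).prod (P.map (X u))) =
        (P.map fun ω t => R t ω).prod ((P.map (X u)).map (· + c)) := by
      have : SFinite (P.map (X u)) := inferInstance
      have := Measure.map_prod_map (P.map fun ω t => R t ω) (P.map (X u)) measurable_id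
        (measurable_add_const c)
      rw [Measure.map_id] at this
      rw [this]
      rfl
    rw [e1, ← this, Measure.map_map mS mF, Measure.map_map mF (by fun_prop)]
    congr 1
    ext p t
    simp [hF]
    ring
  rw [e2, e1]
  refine Measure.AbsolutelyContinuous.map ?_ mF
  have : SFinite ((P.map (X u)).map (· + c)) := inferInstance
  refine Measure.AbsolutelyContinuous.prod Measure.AbsolutelyContinuous.rfl ?_
  rw [(hX.hasGaussianLaw_eval u).map_eq_gaussianReal, hu, gaussianReal_map_add_const]
  -- Both nondegenerate Gaussians are equivalent to Lebesgue measure.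
  exact (gaussianReal_absolutelyContinuous _ (by simp)).trans
    (gaussianReal_absolutelyContinuous' _ (by simp))

theorem Measure.AbsolutelyContinuous.pi_fin {α : Type*} [MeasurableSpace α] {n : ℕ}
    {μ ν : Fin n → Measure α} [∀ i, IsProbabilityMeasure (μ i)] [∀ i, IsProbabilityMeasure (ν i)]
    (h : ∀ i, μ i ≪ ν i) : Measure.pi μ ≪ Measure.pi ν := by
  induction n with
  | zero => rw [Measure.pi_of_empty μ, Measure.pi_of_empty ν]
  | succ n ih =>
    have e : ∀ (μ : Fin (n + 1) → Measure α) [∀ i, IsProbabilityMeasure (μ i)],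
        Measure.pi μ = ((μ 0).prod (Measure.pi fun j => μ (Fin.succAbove 0 j))).map
          (MeasurableEquiv.piFinSuccAbove (fun _ => α) 0).symm := fun μ _ =>
      ((measurePreserving_piFinSuccAbove μ 0).symm _).map_eq.symm
    rw [e μ, e ν]
    refine Measure.AbsolutelyContinuous.map ?_ (MeasurableEquiv.measurable _)
    exact (h 0).prod (ih fun i => h _)

/-! ### The algebra spanned by covariance sections on the circle -/

/-- The function `exp (a cos t + b sin t)`, up to a factor the restriction to the unit circle of a
section of the covariance of the field. -/
noncomputable def circleExp (u : ℝ × ℝ) : ℝ → ℝ :=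
  fun t => Real.exp (u.1 * Real.cos t + u.2 * Real.sin t)

/-- The linear span of the functions `circleExp u`. -/
noncomputable def circleExpSpan : Submodule ℝ (ℝ → ℝ) := Submodule.span ℝ (Set.range circleExp)

theorem circleExp_mul (u v : ℝ × ℝ) : circleExp u * circleExp v = circleExp (u + v) := by
  ext t
  simp only [circleExp, Pi.mul_apply, ← Real.exp_add, Prod.fst_add, Prod.snd_add]
  ring_nf

theorem mul_mem_circleExpSpan {p q : ℝ → ℝ} (hp : p ∈ circleExpSpan) (hq : q ∈ circleExpSpan) :
    p * q ∈ circleExpSpan := by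
  have h := Submodule.mul_mem_mul hp hq
  rw [circleExpSpan, Submodule.span_mul_span] at h
  refine Submodule.span_mono ?_ h
  rintro _ ⟨_, ⟨u, rfl⟩, _, ⟨v, rfl⟩, rfl⟩
  exact ⟨u + v, (circleExp_mul u v).symm⟩

theorem const_mem_circleExpSpan (c : ℝ) : (fun _ => c) ∈ circleExpSpan := by
  have h : (fun _ => c : ℝ → ℝ) = c • circleExp 0 := by ext t; simp [circleExp]
  rw [h]
  exact Submodule.smul_mem _ _ (Submodule.subset_span ⟨_, rfl⟩)

/-! ### Admissible shifts of the random curve -/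

section

variable {Ω : Type*} [MeasurableSpace Ω] {P : Measure Ω} {ξ : Plane → Ω → Space}

theorem measurable_add_fun {T : Type*} (h : T → ℝ) :
    Measurable (fun (y : T → ℝ) t => y t + h t) :=
  measurable_pi_lambda _ fun t => (measurable_pi_apply t).add_const _

theorem IsStationaryGaussianField.measurable_coord (hξ : IsStationaryGaussianField P ξ)
    (i : Fin 3) (u : Plane) : Measurable fun ω => ξ u ω i :=
  (EuclideanSpace.proj (𝕜 := ℝ) i).continuous.measurable.comp (hξ.measurable u)

theorem IsStationaryGaussianField.cov_eq [IsProbabilityMeasure P]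
    (hξ : IsStationaryGaussianField P ξ)
    (i : Fin 3) (u v : Plane) :
    cov[fun ω => ξ u ω i, fun ω => ξ v ω i; P] = Real.exp (-‖u - v‖ ^ 2) := by
  rw [covariance_eq_sub ((hξ.gaussian i).hasGaussianLaw_eval u).memLp_two
    ((hξ.gaussian i).hasGaussianLaw_eval v).memLp_two, hξ.centered, ← hξ.covariance i u v]
  simp

/-- The law of a coordinate of the random curve. -/
noncomputable def coordLaw (P : Measure Ω) (ξ : Plane → Ω → Space) (i : Fin 3) :
    Measure (ℝ → ℝ) := P.map fun ω t => randomCurve ξ ω t i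

theorem IsStationaryGaussianField.measurable_coordCurve (hξ : IsStationaryGaussianField P ξ)
    (i : Fin 3) : Measurable fun ω t => randomCurve ξ ω t i :=
  measurable_pi_lambda _ fun _ => hξ.measurable_coord i _

/-- For v on the unit circle, -‖w - v‖² = -‖w‖² - 1 + 2⟨w, v⟩. Taking w = u/2 makes the last term u₁
cos t + u₂ sin t, and the factor exp(‖w‖² + 1) cancels the constants. -/
theorem coordLaw_shift_circleExp [IsProbabilityMeasure P] (hξ : IsStationaryGaussianField P ξ)
    (i : Fin 3) (u : ℝ × ℝ) (c : ℝ) :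
    coordLaw P ξ i ≪ (coordLaw P ξ i).map fun y t => y t + (c • circleExp u) t := by
  set w : Plane := !₂[u.1 / 2, u.2 / 2] with hw
  have hvar : Var[fun ω => ξ w ω i; P] = 1 := by
    rw [← covariance_self (hξ.measurable_coord i w).aemeasurable, hξ.cov_eq]
    simp
  have key := map_absolutelyContinuous_shift (hξ.gaussian i) (hξ.measurable_coord i) w hvar
    (c * Real.exp (‖w‖ ^ 2 + 1))
  simp only [hξ.cov_eq] at key
  set r : (Plane → ℝ) → (ℝ → ℝ) := fun y t => y !₂[Real.cos t, Real.sin t] with hr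
  have mr : Measurable r := measurable_pi_lambda _ fun _ => measurable_pi_apply _
  have mX : Measurable fun ω (v : Plane) => ξ v ω i :=
    measurable_pi_lambda _ fun v => hξ.measurable_coord i v
  have e1 : coordLaw P ξ i = (P.map fun ω (v : Plane) => ξ v ω i).map r := by
    rw [Measure.map_map mr mX]; rfl
  have e2 : (coordLaw P ξ i).map (fun y t => y t + (c • circleExp u) t) =
      ((P.map fun ω (v : Plane) => ξ v ω i).map
        fun y v => y v + c * Real.exp (‖w‖ ^ 2 + 1) * Real.exp (-‖w - v‖ ^ 2)).map r := by
    rw [e1, Measure.map_map (measurable_add_fun _) mr, Measure.map_map mr (measurable_add_fun _)]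
    congr 1
    ext y t
    simp only [hr, Function.comp, Pi.smul_apply, smul_eq_mul, circleExp, mul_assoc,
      ← Real.exp_add]
    congr 3
    simp only [hw, EuclideanSpace.norm_sq_eq, Fin.sum_univ_two, Real.norm_eq_abs, sq_abs]
    simp
    nlinarith [Real.sin_sq_add_cos_sq t]
  rw [e2, e1]
  exact key.map mr

/-- Admissible shifts compose, so they add. Carrying all real multiples through the span induction
makes the scalar step immediate. -/
theorem coordLaw_shift [IsProbabilityMeasure P] (hξ : IsStationaryGaussianField P ξ)
    (i : Fin 3) {h : ℝ → ℝ} (hh : h ∈ circleExpSpan) :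
    coordLaw P ξ i ≪ (coordLaw P ξ i).map fun y t => y t + h t := by
  suffices H : ∀ c : ℝ, coordLaw P ξ i ≪ (coordLaw P ξ i).map fun y t => y t + (c • h) t by
    simpa using H 1
  induction hh using Submodule.span_induction with
  | mem x hx =>
    obtain ⟨u, rfl⟩ := hx
    exact coordLaw_shift_circleExp hξ i u
  | zero =>
    intro c
    have : (fun (y : ℝ → ℝ) t => y t + (c • (0 : ℝ → ℝ)) t) = id := by ext; simp
    rw [this, Measure.map_id]
  | add x y _ _ hx hy =>
    intro c
    refine (hy c).trans ?_
    have := (hx c).map (measurable_add_fun (c • y))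
    rw [Measure.map_map (measurable_add_fun _) (measurable_add_fun _)] at this
    convert this using 2
    ext z t
    simp
    ring
  | smul a x _ hx =>
    intro c
    simpa [mul_assoc] using hx (c * a)

/-- An event for the shifted random curve has positive probability if it has for the random
curve itself. -/
theorem pos_of_shift [IsProbabilityMeasure P] (hξ : IsStationaryGaussianField P ξ)
    {h : Fin 3 → ℝ → ℝ} (hh : ∀ i, h i ∈ circleExpSpan) {B : Set (Fin 3 → ℝ → ℝ)}
    (hB : MeasurableSet B) (hpos : 0 < P {ω | (fun i t => randomCurve ξ ω t i) ∈ B}) :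
    0 < P {ω | (fun i t => randomCurve ξ ω t i + h i t) ∈ B} := by
  have mi := hξ.measurable_coordCurve
  have m : Measurable fun ω (i : Fin 3) t => randomCurve ξ ω t i := measurable_pi_lambda _ mi
  have hind : iIndepFun (fun (i : Fin 3) ω t => randomCurve ξ ω t i) P :=
    hξ.indep.comp (fun _ (y : Plane → ℝ) t => y !₂[Real.cos t, Real.sin t])
      fun _ => measurable_pi_lambda _ fun _ => measurable_pi_apply _
  have hlaw : P.map (fun ω i t => randomCurve ξ ω t i) = Measure.pi (coordLaw P ξ) :=
    (iIndepFun_iff_map_fun_eq_pi_map fun i => (mi i).aemeasurable).1 hind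
  have hp : ∀ i, IsProbabilityMeasure (coordLaw P ξ i) := fun i =>
    Measure.isProbabilityMeasure_map (mi i).aemeasurable
  have hp' : ∀ i, IsProbabilityMeasure ((coordLaw P ξ i).map fun y t => y t + h i t) := fun i =>
    Measure.isProbabilityMeasure_map (measurable_add_fun _).aemeasurable
  have hac := Measure.AbsolutelyContinuous.pi_fin fun i => coordLaw_shift hξ i (hh i)
  have mS : Measurable fun (y : Fin 3 → ℝ → ℝ) i t => y i t + h i t :=
    measurable_pi_lambda _ fun i => (measurable_add_fun (h i)).comp (measurable_pi_apply i)
  rw [← Measure.pi_map_pi fun i => (measurable_add_fun (h i)).aemeasurable, ← hlaw,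
    Measure.map_map mS m] at hac
  rw [pos_iff_ne_zero] at hpos ⊢
  intro h0
  apply hpos
  have := hac (s := B) (by rw [Measure.map_apply (mS.comp m) hB]; exact h0)
  rwa [Measure.map_apply m hB] at this

end

/-! ### Lipschitz approximation of periodic functions -/

/-- `M` bounds the absolute value and the Lipschitz constant of `h`. -/
def LipBound (M : ℝ) (h : ℝ → ℝ) : Prop :=
  (∀ t, |h t| ≤ M) ∧ ∀ s t, |h s - h t| ≤ M * |s - t|

theorem LipBound.nonneg {M : ℝ} {h : ℝ → ℝ} (H : LipBound M h) : 0 ≤ M :=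
  (abs_nonneg _).trans (H.1 0)

theorem LipBound.mono {M N : ℝ} {h : ℝ → ℝ} (H : LipBound M h) (hMN : M ≤ N) : LipBound N h :=
  ⟨fun t => (H.1 t).trans hMN,
    fun s t => (H.2 s t).trans (mul_le_mul_of_nonneg_right hMN (abs_nonneg _))⟩

theorem LipBound.add {M N : ℝ} {g h : ℝ → ℝ} (hg : LipBound M g) (hh : LipBound N h) :
    LipBound (M + N) (g + h) := by
  refine ⟨fun t => (abs_add_le _ _).trans (add_le_add (hg.1 t) (hh.1 t)), fun s t => ?_⟩
  have e : (g + h) s - (g + h) t = (g s - g t) + (h s - h t) := by simp; ring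
  rw [e, add_mul]
  exact (abs_add_le _ _).trans (add_le_add (hg.2 s t) (hh.2 s t))

theorem LipBound.smul {M : ℝ} {h : ℝ → ℝ} (H : LipBound M h) (c : ℝ) :
    LipBound (|c| * M) (c • h) := by
  refine ⟨fun t => ?_, fun s t => ?_⟩
  · rw [Pi.smul_apply, smul_eq_mul, abs_mul]
    exact mul_le_mul_of_nonneg_left (H.1 t) (abs_nonneg c)
  · simp only [Pi.smul_apply, smul_eq_mul, ← mul_sub, abs_mul, mul_assoc]
    exact mul_le_mul_of_nonneg_left (H.2 s t) (abs_nonneg c)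

theorem LipBound.mul {M N : ℝ} {g h : ℝ → ℝ} (hg : LipBound M g) (hh : LipBound N h) :
    LipBound (2 * M * N) (g * h) := by
  have h0 := mul_nonneg hg.nonneg hh.nonneg
  refine ⟨fun t => ?_, fun s t => ?_⟩
  · rw [Pi.mul_apply, abs_mul]
    have := mul_le_mul (hg.1 t) (hh.1 t) (abs_nonneg _) hg.nonneg
    linarith
  · have e : (g * h) s - (g * h) t = g s * (h s - h t) + (g s - g t) * h t := by
      simp; ring
    rw [e]
    refine (abs_add_le _ _).trans ?_
    rw [abs_mul, abs_mul]
    have h1 := mul_le_mul (hg.1 s) (hh.2 s t) (abs_nonneg _) hg.nonneg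
    have h2 := mul_le_mul (hg.2 s t) (hh.1 t) (abs_nonneg _)
      (mul_nonneg hg.nonneg (abs_nonneg _))
    calc _ ≤ _ := add_le_add h1 h2
      _ = _ := by ring

theorem abs_sub_le_of_hasDerivAt {f f' : ℝ → ℝ} {C : ℝ} (hf : ∀ t, HasDerivAt f (f' t) t)
    (hC : ∀ t, |f' t| ≤ C) (s t : ℝ) : |f s - f t| ≤ C * |s - t| :=
  convex_univ.norm_image_sub_le_of_norm_hasDerivWithin_le
    (fun x _ => (hf x).hasDerivWithinAt) (fun x _ => hC x) (Set.mem_univ t) (Set.mem_univ s)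

/-- The bounded Lipschitz periodic functions that are limits of elements of `circleExpSpan`, in
the uniform norm and the Lipschitz seminorm together. -/
structure Approximable (h : ℝ → ℝ) : Prop where
  bound : ∃ M, LipBound M h
  periodic : Function.Periodic h (2 * Real.pi)
  approx : ∀ ε > 0, ∃ p ∈ circleExpSpan, LipBound ε (h - p)

theorem Approximable.add {g h : ℝ → ℝ} (hg : Approximable g) (hh : Approximable h) :
    Approximable (g + h) := by
  refine ⟨?_, hg.periodic.add hh.periodic, fun ε hε => ?_⟩
  · obtain ⟨M, hM⟩ := hg.bound
    obtain ⟨N, hN⟩ := hh.bound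
    exact ⟨_, hM.add hN⟩
  · obtain ⟨p, hp, hp'⟩ := hg.approx (ε / 2) (half_pos hε)
    obtain ⟨q, hq, hq'⟩ := hh.approx (ε / 2) (half_pos hε)
    refine ⟨p + q, Submodule.add_mem _ hp hq, ?_⟩
    have := hp'.add hq'
    rwa [add_halves, ← add_sub_add_comm] at this

theorem Approximable.smul {h : ℝ → ℝ} (hh : Approximable h) (c : ℝ) : Approximable (c • h) := by
  refine ⟨?_, fun t => by simp [hh.periodic t], fun ε hε => ?_⟩
  · obtain ⟨M, hM⟩ := hh.bound
    exact ⟨_, hM.smul c⟩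
  · obtain ⟨p, hp, hp'⟩ := hh.approx (ε / (|c| + 1)) (by positivity)
    refine ⟨c • p, Submodule.smul_mem _ _ hp, ?_⟩
    rw [← smul_sub]
    refine (hp'.smul c).mono ?_
    rw [← mul_div_assoc, div_le_iff₀ (by positivity)]
    nlinarith [abs_nonneg c]

theorem Approximable.sub {g h : ℝ → ℝ} (hg : Approximable g) (hh : Approximable h) :
    Approximable (g - h) := by
  have := hg.add (hh.smul (-1))
  rwa [neg_one_smul, ← sub_eq_add_neg] at this

theorem Approximable.mul {g h : ℝ → ℝ} (hg : Approximable g) (hh : Approximable h) :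
    Approximable (g * h) := by
  obtain ⟨M, hM⟩ := hg.bound
  obtain ⟨N, hN⟩ := hh.bound
  refine ⟨⟨_, hM.mul hN⟩, hg.periodic.mul hh.periodic, fun ε hε => ?_⟩
  have hM0 := hM.nonneg
  have hN0 := hN.nonneg
  set δ := min 1 (ε / (2 * M + 2 * N + 2)) with hδ
  have hδ0 : 0 < δ := by positivity
  have hδ1 : δ ≤ 1 := min_le_left _ _
  have hδε : δ * (2 * M + 2 * N + 2) ≤ ε := by
    rw [← le_div_iff₀ (by positivity)]; exact min_le_right _ _
  obtain ⟨p, hp, hp'⟩ := hg.approx δ hδ0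
  obtain ⟨q, hq, hq'⟩ := hh.approx δ hδ0
  refine ⟨p * q, mul_mem_circleExpSpan hp hq, ?_⟩
  -- This expansion uses only the bounds of `g`, `h` and the two errors; its terms add up to 2Mδ +
  -- 2δN + 2δ², at most ε by the choice of δ ≤ 1.
  have e : g * h - p * q = g * (h - q) + ((g - p) * h + (-1 : ℝ) • ((g - p) * (h - q))) := by
    ext t
    simp
    ring
  rw [e]
  refine ((hM.mul hq').add ((hp'.mul hN).add ((hp'.mul hq').smul (-1)))).mono ?_
  rw [abs_neg, abs_one, one_mul]
  nlinarith

theorem approximable_const (c : ℝ) : Approximable fun _ => c :=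
  ⟨⟨|c|, fun _ => le_rfl, fun s t => by simp; positivity⟩, fun _ => rfl,
    fun ε hε => ⟨_, const_mem_circleExpSpan c, by simp; positivity,
      fun s t => by simp; positivity⟩⟩

/-- The quotient (exp(s g) - 1)/s tends to g as s → 0: for 0 < s ≤ 1 the error and its derivative
g'(1 - exp(s g)) are both at most 2s in absolute value. -/
theorem approximable_of_exp_mem {g g' : ℝ → ℝ} (hg : ∀ t, HasDerivAt g (g' t) t)
    (h1 : ∀ t, |g t| ≤ 1) (h1' : ∀ t, |g' t| ≤ 1) (hper : Function.Periodic g (2 * Real.pi))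
    (hmem : ∀ s : ℝ, (fun t => Real.exp (s * g t)) ∈ circleExpSpan) : Approximable g := by
  refine ⟨⟨1, h1, abs_sub_le_of_hasDerivAt hg h1'⟩, hper, fun ε hε => ?_⟩
  set s := min 1 (ε / 2) with hs
  have hs0 : 0 < s := by positivity
  have hs1 : s ≤ 1 := min_le_left _ _
  have hsε : 2 * s ≤ ε := by
    have : s ≤ ε / 2 := min_le_right _ _
    linarith
  have hx : ∀ t, |s * g t| ≤ s := fun t => by
    rw [abs_mul, abs_of_pos hs0]
    exact mul_le_of_le_one_right hs0.le (h1 t)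
  refine ⟨s⁻¹ • ((fun t => Real.exp (s * g t)) - fun _ => 1), Submodule.smul_mem _ _
    (Submodule.sub_mem _ (hmem s) (const_mem_circleExpSpan 1)), LipBound.mono ⟨fun t => ?_, ?_⟩ hsε⟩
  · have h2 := Real.abs_exp_sub_one_sub_id_le ((hx t).trans hs1)
    have e : (g - s⁻¹ • ((fun t => Real.exp (s * g t)) - fun _ => 1) : ℝ → ℝ) t =
        -(s⁻¹ * (Real.exp (s * g t) - 1 - s * g t)) := by
      simp
      field_simp
      ring
    rw [e, abs_neg, abs_mul, abs_inv, abs_of_pos hs0, inv_mul_le_iff₀ hs0]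
    refine h2.trans ?_
    have h3 := sq_le_sq' (neg_le_of_abs_le (hx t)) (le_of_abs_le (hx t))
    nlinarith
  · refine abs_sub_le_of_hasDerivAt (f' := fun t => g' t * (1 - Real.exp (s * g t)))
      (fun t => ?_) (fun t => ?_)
    · have h4 := (hg t).sub ((((hg t).const_mul s).exp.sub_const 1).const_smul s⁻¹)
      refine h4.congr_deriv ?_
      simp
      field_simp
    · rw [abs_mul, abs_sub_comm]
      have h2 := Real.abs_exp_sub_one_le ((hx t).trans hs1)
      calc |g' t| * |Real.exp (s * g t) - 1| ≤ 1 * (2 * s) :=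
            mul_le_mul (h1' t) (h2.trans (by linarith [hx t])) (abs_nonneg _) zero_le_one
        _ = 2 * s := one_mul _

theorem approximable_cos : Approximable Real.cos := by
  refine approximable_of_exp_mem Real.hasDerivAt_cos Real.abs_cos_le_one
    (fun t => by simpa using Real.abs_sin_le_one t) Real.cos_periodic fun s => ?_
  refine Submodule.subset_span ⟨(s, 0), ?_⟩
  ext t
  simp [circleExp]

theorem approximable_sin : Approximable Real.sin := by
  refine approximable_of_exp_mem Real.hasDerivAt_sin Real.abs_sin_le_one
    Real.abs_cos_le_one Real.sin_periodic fun s => ?_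
  refine Submodule.subset_span ⟨(0, s), ?_⟩
  ext t
  simp [circleExp]

theorem approximable_cos_sin_nat (n : ℕ) :
    (Approximable fun t => Real.cos (n * t)) ∧ Approximable fun t => Real.sin (n * t) := by
  induction n with
  | zero => simpa using ⟨approximable_const 1, approximable_const 0⟩
  | succ n ih =>
    constructor
    · convert (ih.1.mul approximable_cos).sub (ih.2.mul approximable_sin) using 1
      ext t
      simp [add_mul, Real.cos_add]
    · convert (ih.2.mul approximable_cos).add (ih.1.mul approximable_sin) using 1
      ext t
      simp [add_mul, Real.sin_add]

theorem approximable_cos_sin (n : ℤ) :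
    (Approximable fun t => Real.cos (n * t)) ∧ Approximable fun t => Real.sin (n * t) := by
  obtain ⟨m, rfl | rfl⟩ := n.eq_nat_or_neg
  · exact_mod_cast approximable_cos_sin_nat m
  · have := approximable_cos_sin_nat m
    refine ⟨by simpa using this.1, ?_⟩
    convert this.2.smul (-1) using 1
    ext t
    simp

/-- A trigonometric polynomial minus its mean has an approximable antiderivative. -/
theorem exists_approximable_antideriv {q : C(AddCircle (2 * Real.pi), ℂ)}
    (hq : q ∈ Submodule.span ℂ (Set.range (fourier (T := 2 * Real.pi)))) :
    ∃ (Q₁ Q₂ : ℝ → ℝ) (c₁ c₂ : ℝ), Approximable Q₁ ∧ Approximable Q₂ ∧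
      (∀ t : ℝ, HasDerivAt Q₁ ((q t).re - c₁) t) ∧ ∀ t : ℝ, HasDerivAt Q₂ ((q t).im - c₂) t := by
  induction hq using Submodule.span_induction with
  | mem x hx =>
    obtain ⟨n, rfl⟩ := hx
    have hval : ∀ t : ℝ, fourier n (t : AddCircle (2 * Real.pi)) =
        Real.cos (n * t) + Real.sin (n * t) * Complex.I := by
      intro t
      rw [fourier_coe_apply, Complex.ofReal_cos, Complex.ofReal_sin, ← Complex.exp_mul_I]
      congr 1
      have : (Real.pi : ℂ) ≠ 0 := by exact_mod_cast Real.pi_ne_zero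
      push_cast
      field_simp
    have hre : ∀ t : ℝ, (fourier n (t : AddCircle (2 * Real.pi))).re = Real.cos (n * t) := by
      intro t; rw [hval]; simp [-Complex.ofReal_cos, -Complex.ofReal_sin]
    have him : ∀ t : ℝ, (fourier n (t : AddCircle (2 * Real.pi))).im = Real.sin (n * t) := by
      intro t; rw [hval]; simp [-Complex.ofReal_cos, -Complex.ofReal_sin]
    simp only [hre, him]
    -- The constant mode has no periodic antiderivative; it is absorbed in `c₁`.
    by_cases hn : n = 0
    · subst hn
      refine ⟨fun _ => 0, fun _ => 0, 1, 0, approximable_const 0, approximable_const 0, ?_, ?_⟩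
      · intro t; simpa using hasDerivAt_const t (0 : ℝ)
      · intro t; simpa using hasDerivAt_const t (0 : ℝ)
    · have hn' : (n : ℝ) ≠ 0 := by exact_mod_cast hn
      refine ⟨(n : ℝ)⁻¹ • fun t => Real.sin (n * t), (-(n : ℝ)⁻¹) • fun t => Real.cos (n * t),
        0, 0, (approximable_cos_sin n).2.smul _, (approximable_cos_sin n).1.smul _, ?_, ?_⟩
      · intro t
        refine ((((hasDerivAt_id t).const_mul (n : ℝ)).sin).const_smul (n : ℝ)⁻¹).congr_deriv ?_
        simp
        field_simp
      · intro t
        refine ((((hasDerivAt_id t).const_mul (n : ℝ)).cos).const_smul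
          (-(n : ℝ)⁻¹)).congr_deriv ?_
        simp
        field_simp
  | zero =>
    refine ⟨fun _ => 0, fun _ => 0, 0, 0, approximable_const 0, approximable_const 0, ?_, ?_⟩
    · intro t; simpa using hasDerivAt_const t (0 : ℝ)
    · intro t; simpa using hasDerivAt_const t (0 : ℝ)
  | add x y _ _ hx hy =>
    obtain ⟨X₁, X₂, a₁, a₂, hX₁, hX₂, dX₁, dX₂⟩ := hx
    obtain ⟨Y₁, Y₂, b₁, b₂, hY₁, hY₂, dY₁, dY₂⟩ := hy
    refine ⟨X₁ + Y₁, X₂ + Y₂, a₁ + b₁, a₂ + b₂, hX₁.add hY₁, hX₂.add hY₂,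
      fun t => ((dX₁ t).add (dY₁ t)).congr_deriv ?_, fun t => ((dX₂ t).add (dY₂ t)).congr_deriv ?_⟩
    · simp; ring
    · simp; ring
  | smul c x _ hx =>
    obtain ⟨X₁, X₂, a₁, a₂, hX₁, hX₂, dX₁, dX₂⟩ := hx
    refine ⟨c.re • X₁ - c.im • X₂, c.re • X₂ + c.im • X₁, c.re * a₁ - c.im * a₂,
      c.re * a₂ + c.im * a₁, (hX₁.smul _).sub (hX₂.smul _), (hX₂.smul _).add (hX₁.smul _),
      fun t => (((dX₁ t).const_smul c.re).sub ((dX₂ t).const_smul c.im)).congr_deriv ?_,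
      fun t => (((dX₂ t).const_smul c.re).add ((dX₁ t).const_smul c.im)).congr_deriv ?_⟩
    · simp; ring
    · simp; ring

/-- Periodic continuously differentiable functions are limits of elements of `circleExpSpan` in the
Lipschitz seminorm. -/
theorem exists_mem_circleExpSpan_close {h : ℝ → ℝ} (hh : ContDiff ℝ 1 h)
    (hper : Function.Periodic h (2 * Real.pi)) {ε : ℝ} (hε : 0 < ε) :
    ∃ p ∈ circleExpSpan, ∀ s t, |(h s - p s) - (h t - p t)| ≤ ε * |s - t| := by
  have hpi := Real.pi_pos
  have hd : ∀ t, HasDerivAt h (deriv h t) t := fun t =>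
    (hh.differentiable one_ne_zero t).hasDerivAt
  have hper' : Function.Periodic (fun t => ((deriv h t : ℝ) : ℂ)) (2 * Real.pi) := fun t => by
    have : deriv h (t + 2 * Real.pi) = deriv h t := by
      rw [← deriv_comp_add_const]
      congr 1
      exact funext hper
    simp [this]
  let H : C(AddCircle (2 * Real.pi), ℂ) :=
    ⟨hper'.lift, continuous_coinduced_dom.2
      (Complex.continuous_ofReal.comp (hh.continuous_deriv le_rfl))⟩
  have hfact : Fact (0 < 2 * Real.pi) := ⟨by positivity⟩
  have hH : H ∈ (Submodule.span ℂ (Set.range (fourier (T := 2 * Real.pi)))).topologicalClosure := by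
    rw [span_fourier_closure_eq_top]; trivial
  obtain ⟨q, hq, hqd⟩ := Metric.mem_closure_iff.1 hH (ε / 3) (by positivity)
  obtain ⟨Q, -, c, -, hQ, -, dQ, -⟩ := exists_approximable_antideriv hq
  have hclose : ∀ t : ℝ, |deriv h t - (q t).re| ≤ ε / 3 := fun t => by
    have h1 : ‖H t - q t‖ ≤ ε / 3 := by
      rw [← dist_eq_norm]
      exact (ContinuousMap.dist_apply_le_dist _).trans hqd.le
    have h2 : H t = ((deriv h t : ℝ) : ℂ) := rfl
    have h3 := (Complex.abs_re_le_norm _).trans h1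
    simpa [h2] using h3
  have hl := abs_sub_le_of_hasDerivAt (f := fun t => h t - Q t - c * t)
    (f' := fun t => deriv h t - ((q t).re - c) - c * 1) (C := ε / 3)
    (fun t => ((hd t).sub (dQ t)).sub ((hasDerivAt_id t).const_mul c))
    (fun t => by
      have e : deriv h t - ((q t).re - c) - c * 1 = deriv h t - (q t).re := by ring
      rw [e]; exact hclose t)
  -- Since `h - Q` is periodic, the increment of `h - Q - c t` over a full period is -2πc, so its
  -- Lipschitz bound controls the mean `c`.
  have hc : |c| ≤ ε / 3 := by
    have h1 := hl (2 * Real.pi) 0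
    have e1 := hper 0
    have e2 := hQ.periodic 0
    rw [zero_add] at e1 e2
    rw [e1, e2] at h1
    have e3 : h 0 - Q 0 - c * (2 * Real.pi) - (h 0 - Q 0 - c * 0) = -(c * (2 * Real.pi)) := by ring
    rw [e3, abs_neg, abs_mul, sub_zero] at h1
    exact le_of_mul_le_mul_right h1 (by positivity)
  obtain ⟨p, hp, hp'⟩ := hQ.approx (ε / 3) (by positivity)
  refine ⟨p, hp, fun s t => ?_⟩
  have e : (h s - p s) - (h t - p t) = ((h s - Q s - c * s) - (h t - Q t - c * t)) +
      (((Q - p) s - (Q - p) t) + c * (s - t)) := by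
    simp; ring
  rw [e]
  have h1 := hl s t
  have h2 := hp'.2 s t
  have h3 : |c * (s - t)| ≤ ε / 3 * |s - t| := by
    rw [abs_mul]; exact mul_le_mul_of_nonneg_right hc (abs_nonneg _)
  calc _ ≤ _ := (abs_add_le _ _).trans (add_le_add h1 ((abs_add_le _ _).trans (add_le_add h2 h3)))
    _ = ε * |s - t| := by ring

/-! ### Ambient isotopy and stability of knots -/

/-- Undoing `H 1` and then running `H` backwards in time avoids joint continuity of the inverses. -/
theorem AmbientIsotopic.symm {K L : Set Space} (h : AmbientIsotopic K L) :
    AmbientIsotopic L K := by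
  obtain ⟨H, hc, h0, h1⟩ := h
  refine ⟨fun s => (H 1).symm.trans (H (unitInterval.symm s)), ?_, fun x => ?_, ?_⟩
  · exact hc.comp (Continuous.prodMk (unitInterval.continuous_symm.comp continuous_fst)
      ((H 1).symm.continuous.comp continuous_snd))
  · simp
  · rw [← h1]
    ext x
    simp [h0]

theorem AmbientIsotopic.trans {K L M : Set Space} (h : AmbientIsotopic K L)
    (h' : AmbientIsotopic L M) : AmbientIsotopic K M := by
  obtain ⟨H, hc, h0, h1⟩ := h
  obtain ⟨H', hc', h0', h1'⟩ := h'
  refine ⟨fun s => (H s).trans (H' s), ?_, fun x => ?_, ?_⟩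
  · exact hc'.comp (continuous_fst.prodMk hc)
  · simp [h0, h0']
  · rw [← h1', ← h1, Set.image_image]
    rfl

/-- Moving the points of a set by a displacement with small Lipschitz constant is the end of an
ambient isotopy. -/
theorem ambientIsotopic_image_add {K : Set Space} {φ : Space → Space} {c : NNReal}
    (hφ : LipschitzOnWith c φ K) (hc : lipschitzExtensionConstant Space * c < 1) :
    AmbientIsotopic K ((fun x => x + φ x) '' K) := by
  -- The extension to all of space has Lipschitz constant `k < 1`, so each x + s Φ(x) is a
  -- contraction perturbation of the identity, hence a homeomorphism.
  obtain ⟨Φ, hΦ, heq⟩ := hφ.extend_finite_dimension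
  set k := lipschitzExtensionConstant Space * c
  have happ : ∀ s : I, ApproximatesLinearOn (fun x => x + (s : ℝ) • Φ x)
      ((ContinuousLinearEquiv.refl ℝ Space : Space ≃L[ℝ] Space) : Space →L[ℝ] Space)
      Set.univ k := by
    intro s x _ y _
    have e : x + (s : ℝ) • Φ x - (y + (s : ℝ) • Φ y) -
        ((ContinuousLinearEquiv.refl ℝ Space : Space ≃L[ℝ] Space) : Space →L[ℝ] Space) (x - y) =
        (s : ℝ) • (Φ x - Φ y) := by
      simp [smul_sub]
      abel
    rw [e, norm_smul, Real.norm_eq_abs, abs_of_nonneg s.2.1]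
    calc (s : ℝ) * ‖Φ x - Φ y‖ ≤ 1 * ‖Φ x - Φ y‖ :=
          mul_le_mul_of_nonneg_right s.2.2 (norm_nonneg _)
      _ = ‖Φ x - Φ y‖ := one_mul _
      _ ≤ k * ‖x - y‖ := by simpa [dist_eq_norm] using hΦ.dist_le_mul x y
  have hk : k < ‖(((ContinuousLinearEquiv.refl ℝ Space).symm : Space ≃L[ℝ] Space) :
      Space →L[ℝ] Space)‖₊⁻¹ := by
    have : ‖(((ContinuousLinearEquiv.refl ℝ Space).symm : Space ≃L[ℝ] Space) :
        Space →L[ℝ] Space)‖₊ = 1 := by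
      ext
      exact ContinuousLinearMap.norm_id
    rwa [this, inv_one]
  refine ⟨fun s => (happ s).toHomeomorph _ (Or.inr hk), ?_, fun x => ?_, ?_⟩
  · change Continuous fun p : I × Space => p.2 + (p.1 : ℝ) • Φ p.2
    exact continuous_snd.add ((continuous_subtype_val.comp continuous_fst).smul
      (hΦ.continuous.comp continuous_snd))
  · change x + ((0 : I) : ℝ) • Φ x = x
    simp
  · refine Set.image_congr fun x hx => ?_
    change x + ((1 : I) : ℝ) • Φ x = x + φ x
    simp [heq hx]

theorem exists_int_abs_sub_le (s t : ℝ) : ∃ n : ℤ, |s - (t + n • (2 * Real.pi))| ≤ Real.pi := by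
  have hpi := Real.pi_pos
  refine ⟨round ((s - t) / (2 * Real.pi)), ?_⟩
  have h := abs_sub_round ((s - t) / (2 * Real.pi))
  set m : ℝ := ((round ((s - t) / (2 * Real.pi)) : ℤ) : ℝ)
  have e : s - (t + round ((s - t) / (2 * Real.pi)) • (2 * Real.pi)) =
      ((s - t) / (2 * Real.pi) - m) * (2 * Real.pi) := by
    rw [zsmul_eq_mul]
    field_simp
    ring
  rw [e, abs_mul, abs_of_pos (by positivity : 0 < 2 * Real.pi)]
  nlinarith

theorem IsSmoothKnot.ne_of_abs_sub_le {f : ℝ → Space} (hf : IsSmoothKnot f) {s t : ℝ}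
    (hst : s ≠ t) (hle : |s - t| ≤ Real.pi) : f s ≠ f t := by
  have hpi := Real.pi_pos
  intro h
  obtain ⟨m, hm, -⟩ := existsUnique_add_zsmul_mem_Ico (by positivity : 0 < 2 * Real.pi) s 0
  obtain ⟨n, hn, -⟩ := existsUnique_add_zsmul_mem_Ico (by positivity : 0 < 2 * Real.pi) t 0
  rw [zero_add] at hm hn
  have key := hf.injOn hm hn (by rw [hf.periodic.zsmul m s, hf.periodic.zsmul n t, h])
  rw [zsmul_eq_mul, zsmul_eq_mul] at key
  have e : s - t = ((n - m : ℤ) : ℝ) * (2 * Real.pi) := by push_cast; linarith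
  have hnm : n - m ≠ 0 := by
    intro h0
    rw [h0, Int.cast_zero, zero_mul] at e
    exact hst (sub_eq_zero.1 e)
  have h1 : (1 : ℝ) ≤ |((n - m : ℤ) : ℝ)| := by
    exact_mod_cast Int.one_le_abs hnm
  rw [e, abs_mul, abs_of_pos (by positivity : 0 < 2 * Real.pi)] at hle
  nlinarith

/-- A knot is a bi-Lipschitz embedding of the circle. -/
theorem IsSmoothKnot.exists_le_norm_sub {f : ℝ → Space} (hf : IsSmoothKnot f) :
    ∃ c > 0, ∀ s t, |s - t| ≤ Real.pi → c * |s - t| ≤ ‖f s - f t‖ := by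
  have hpi := Real.pi_pos
  have hcd : Continuous (deriv f) := hf.contDiff.continuous_deriv (by norm_num)
  have hd : ∀ t, HasDerivAt f (deriv f t) t := fun t =>
    (hf.contDiff.differentiable (by norm_num) t).hasDerivAt
  -- The mean derivative extends the difference quotient continuously to u = 0. It is nonzero there
  -- by regularity and elsewhere by injectivity; its minimal norm on a compact set is the constant
  -- sought.
  set G : ℝ × ℝ → Space := fun p => ∫ r in (0 : ℝ)..1, deriv f (p.1 + r * p.2) with hG
  have hGc : Continuous G :=
    intervalIntegral.continuous_parametric_intervalIntegral_of_continuous'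
      (f := fun (p : ℝ × ℝ) r => deriv f (p.1 + r * p.2)) (by fun_prop) 0 1
  have hGe : ∀ t u, u • G (t, u) = f (t + u) - f t := by
    intro t u
    have := intervalIntegral.integral_unitInterval_deriv_eq_sub (f := f) (f' := deriv f)
      (z₀ := t) (z₁ := u) (by fun_prop) (fun r _ => hd _)
    simpa [hG] using this
  have hGne : ∀ p ∈ Set.Icc 0 (2 * Real.pi) ×ˢ Set.Icc (-Real.pi) Real.pi, G p ≠ 0 := by
    rintro ⟨t, u⟩ ⟨_, hu⟩
    by_cases hu0 : u = 0
    · subst hu0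
      simpa [hG] using hf.regular t
    · intro h0
      have h1 := hGe t u
      rw [h0, smul_zero] at h1
      refine hf.ne_of_abs_sub_le (s := t + u) (t := t) (by simpa using hu0) ?_
        (sub_eq_zero.1 h1.symm)
      simpa [abs_le] using hu
  obtain ⟨p, hp, hmin⟩ := ((isCompact_Icc.prod isCompact_Icc) :
    IsCompact (Set.Icc 0 (2 * Real.pi) ×ˢ Set.Icc (-Real.pi) Real.pi)).exists_isMinOn
      ⟨(0, 0), by simp; positivity⟩ hGc.norm.continuousOn
  refine ⟨‖G p‖, norm_pos_iff.2 (hGne p hp), fun s t hst => ?_⟩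
  obtain ⟨n, hn, -⟩ := existsUnique_add_zsmul_mem_Ico (by positivity : 0 < 2 * Real.pi) t 0
  rw [zero_add] at hn
  have h1 := hGe (t + n • (2 * Real.pi)) (s - t)
  have e1 : t + n • (2 * Real.pi) + (s - t) = s + n • (2 * Real.pi) := by ring
  rw [e1, hf.periodic.zsmul n s, hf.periodic.zsmul n t] at h1
  rw [← h1, norm_smul, Real.norm_eq_abs, mul_comm]
  refine mul_le_mul_of_nonneg_left ?_ (abs_nonneg _)
  exact hmin (a := (t + n • (2 * Real.pi), s - t)) ⟨⟨hn.1, hn.2.le⟩, abs_le.1 hst⟩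

/-- The difference of the curves `g` and `f` is Lipschitz with constant `ε`. -/
def LipClose (ε : ℝ) (g f : ℝ → Space) : Prop :=
  ∀ s t, ‖(g s - f s) - (g t - f t)‖ ≤ ε * |s - t|

/-- Knots are stable: a closed curve whose difference with a knot has small Lipschitz constant is
a knot of the same type. -/
theorem IsSmoothKnot.exists_stable {f : ℝ → Space} (hf : IsSmoothKnot f) :
    ∃ ε > 0, ∀ g : ℝ → Space, ContDiff ℝ 2 g → Function.Periodic g (2 * Real.pi) →
      LipClose ε g f → IsSmoothKnot g ∧ AmbientIsotopic (Set.range f) (Set.range g) := by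
  have hpi := Real.pi_pos
  obtain ⟨c, hc, hfc⟩ := hf.exists_le_norm_sub
  set k : ℝ := (lipschitzExtensionConstant Space : ℝ) with hk
  have hk0 : 0 < k := lipschitzExtensionConstant_pos Space
  -- Small enough for both ε < c, which keeps `g` regular and injective, and k ε/c < 1, which the
  -- isotopy needs.
  set ε := c / (k + 1) / 2 with hε
  have hε0 : 0 < ε := by positivity
  have hεc : ε < c := by
    rw [hε, div_div, div_lt_iff₀ (by positivity)]
    nlinarith
  have hεk : k * (ε / c) < 1 := by
    rw [← mul_div_assoc, div_lt_one hc, hε, div_div, ← mul_div_assoc, div_lt_iff₀ (by positivity)]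
    nlinarith
  refine ⟨ε, hε0, fun g hg hgper hclose => ?_⟩
  have hlow : ∀ s t, |s - t| ≤ Real.pi → (c - ε) * |s - t| ≤ ‖g s - g t‖ := fun s t hst => by
    have h1 := hfc s t hst
    have h2 := hclose s t
    have h3 : ‖f s - f t‖ ≤ ‖g s - g t‖ + ‖(g s - f s) - (g t - f t)‖ := by
      have e : f s - f t = (g s - g t) - ((g s - f s) - (g t - f t)) := by abel
      rw [e]
      exact norm_sub_le _ _
    linarith
  -- Moving `t` by periods brings it within π of `s`, where the lower bound for `f` turns |s - t|
  -- into distance on the knot.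
  have hδ : ∀ s t, ‖(g s - f s) - (g t - f t)‖ ≤ ε / c * ‖f s - f t‖ := fun s t => by
    obtain ⟨n, hn⟩ := exists_int_abs_sub_le s t
    rw [← hf.periodic.zsmul n t, ← hgper.zsmul n t]
    have h1 := hfc _ _ hn
    have h2 := hclose s (t + n • (2 * Real.pi))
    rw [div_mul_eq_mul_div, le_div_iff₀ hc]
    nlinarith
  refine ⟨⟨hg, hgper, fun t h0 => ?_, fun s hs t ht hst => ?_⟩, ?_⟩
  · have hd : HasDerivAt g 0 t := h0 ▸ (hg.differentiable (by norm_num) t).hasDerivAt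
    have hs := (hasDerivAt_iff_tendsto_slope.1 hd).norm
    rw [norm_zero] at hs
    have hle : c - ε ≤ 0 := by
      refine ge_of_tendsto hs ?_
      have hnear : ∀ᶠ s in nhdsWithin t {t}ᶜ, |s - t| ≤ Real.pi :=
        nhdsWithin_le_nhds (Metric.closedBall_mem_nhds t hpi)
      filter_upwards [hnear, self_mem_nhdsWithin] with s h1 h2
      have h3 := hlow s t h1
      have h4 : 0 < |s - t| := abs_pos.2 (sub_ne_zero.2 h2)
      rw [slope_def_module, norm_smul, norm_inv, Real.norm_eq_abs, le_inv_mul_iff₀ h4]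
      linarith
    linarith
  · by_contra hne
    have hne' : f s ≠ f t := fun h => hne (hf.injOn hs ht h)
    have h1 := hδ s t
    have e : (g s - f s) - (g t - f t) = f t - f s := by rw [hst]; abel
    rw [e, norm_sub_rev] at h1
    have h2 : 0 < ‖f s - f t‖ := norm_pos_iff.2 (sub_ne_zero.2 hne')
    have h3 : ε / c < 1 := (div_lt_one hc).2 hεc
    nlinarith
  -- The displacement as a function of the point f(t); `hδ` makes it well defined.
  · set φ : Space → Space := Function.extend f (fun t => g t - f t) 0
    have hfac : Function.FactorsThrough (fun t => g t - f t) f := fun s t hst => by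
      have h1 := hδ s t
      rw [hst, sub_self, norm_zero, mul_zero] at h1
      exact sub_eq_zero.1 (norm_le_zero_iff.1 (by simpa [hst] using h1))
    have hφ : ∀ t, φ (f t) = g t - f t := fun t => hfac.extend_apply _ t
    have hLip : LipschitzOnWith (ε / c).toNNReal φ (Set.range f) := by
      refine LipschitzOnWith.of_dist_le_mul ?_
      rintro _ ⟨s, rfl⟩ _ ⟨t, rfl⟩
      rw [hφ, hφ, dist_eq_norm, dist_eq_norm, Real.coe_toNNReal _ (by positivity)]
      exact hδ s t
    have := ambientIsotopic_image_add hLip (by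
      rw [← NNReal.coe_lt_coe]
      push_cast
      rwa [Real.coe_toNNReal _ (by positivity)])
    convert this using 1
    rw [← Set.range_comp]
    congr 1
    ext1 t
    simp [hφ]

/-! ### Separability and measurability in the Lipschitz seminorm -/

/-- A family of closed curves is separable for the Lipschitz seminorm. -/
theorem exists_countable_lipClose {Ω : Type*} {γ : Ω → ℝ → Space}
    (hγ : ∀ ω, ContDiff ℝ 1 (γ ω)) (hper : ∀ ω, Function.Periodic (γ ω) (2 * Real.pi))
    (S : Set Ω) {ε : Ω → ℝ} (hε : ∀ ω ∈ S, 0 < ε ω) :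
    ∃ T ⊆ S, T.Countable ∧ ∀ ω ∈ S, ∃ ω' ∈ T, LipClose (ε ω') (γ ω) (γ ω') := by
  have hfact : Fact (0 < 2 * Real.pi) := ⟨by positivity⟩
  have hd : ∀ ω t, HasDerivAt (γ ω) (deriv (γ ω) t) t := fun ω t =>
    ((hγ ω).differentiable one_ne_zero t).hasDerivAt
  have hper' : ∀ ω, Function.Periodic (deriv (γ ω)) (2 * Real.pi) := fun ω t => by
    rw [← deriv_comp_add_const]
    congr 1
    exact funext (hper ω)
  let D : Ω → C(AddCircle (2 * Real.pi), Space) := fun ω =>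
    ⟨(hper' ω).lift, continuous_coinduced_dom.2 ((hγ ω).continuous_deriv le_rfl)⟩
  -- Derivatives lie in the separable space of continuous maps on the circle, so countably many of
  -- the balls cover what all of them cover. The mean value inequality then turns uniform closeness
  -- of derivatives into `LipClose`.
  obtain ⟨T, hTS, hT, hU⟩ := TopologicalSpace.isOpen_biUnion_countable S
    (fun ω => Metric.ball (D ω) (ε ω)) fun _ _ => Metric.isOpen_ball
  refine ⟨T, hTS, hT, fun ω hω => ?_⟩
  have hmem : D ω ∈ ⋃ ω' ∈ T, Metric.ball (D ω') (ε ω') := by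
    rw [hU]
    exact Set.mem_biUnion hω (Metric.mem_ball_self (hε ω hω))
  simp only [Set.mem_iUnion] at hmem
  obtain ⟨ω', hω', hb⟩ := hmem
  refine ⟨ω', hω', fun s t => ?_⟩
  refine convex_univ.norm_image_sub_le_of_norm_hasDerivWithin_le
    (fun x _ => ((hd ω x).sub (hd ω' x)).hasDerivWithinAt) (fun x _ => ?_)
    (Set.mem_univ t) (Set.mem_univ s)
  rw [← dist_eq_norm]
  exact (ContinuousMap.dist_apply_le_dist (f := D ω) (g := D ω')
    (x : AddCircle (2 * Real.pi))).trans hb.le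

/-- The coordinate functions of the curves that are `LipClose ε` to `g`. -/
def lipCloseSet (ε : ℝ) (g : ℝ → Space) : Set (Fin 3 → ℝ → ℝ) :=
  {y | ∀ s t : ℚ, ‖(WithLp.toLp 2 (fun i => y i s) - g s) - (WithLp.toLp 2 (fun i => y i t) - g t)‖
    ≤ ε * |(s : ℝ) - t|}

theorem measurableSet_lipCloseSet (ε : ℝ) (g : ℝ → Space) : MeasurableSet (lipCloseSet ε g) := by
  have hm : ∀ s : ℝ, Measurable fun y : Fin 3 → ℝ → ℝ => (WithLp.toLp 2 fun i => y i s : Space) :=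
    fun s => (PiLp.continuous_toLp 2 _).measurable.comp
      (measurable_pi_lambda _ fun i => (measurable_pi_apply s).comp (measurable_pi_apply i))
  rw [lipCloseSet, Set.ofPred_forall]
  refine MeasurableSet.iInter fun s => ?_
  rw [Set.ofPred_forall]
  refine MeasurableSet.iInter fun t => ?_
  exact measurableSet_le
    (((hm s).sub_const _).sub ((hm t).sub_const _)).norm measurable_const

/-- For continuous curves, rational parameters suffice by density; countably many conditions keep
the set measurable in the product σ-algebra. -/
theorem mem_lipCloseSet_iff {ε : ℝ} {g h : ℝ → Space} (hg : Continuous g) (hh : Continuous h) :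
    (fun i t => h t i) ∈ lipCloseSet ε g ↔ LipClose ε h g := by
  refine ⟨fun H => ?_, fun H s t => H s t⟩
  have hdense : DenseRange (Prod.map ((↑) : ℚ → ℝ) ((↑) : ℚ → ℝ)) :=
    Rat.isDenseEmbedding_coe_real.dense.prodMap Rat.isDenseEmbedding_coe_real.dense
  have hcl : IsClosed {p : ℝ × ℝ | ‖(h p.1 - g p.1) - (h p.2 - g p.2)‖ ≤ ε * |p.1 - p.2|} :=
    isClosed_le (by fun_prop) (by fun_prop)
  intro s t
  exact hdense.induction_on (p := fun p : ℝ × ℝ =>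
    ‖(h p.1 - g p.1) - (h p.2 - g p.2)‖ ≤ ε * |p.1 - p.2|) (s, t) hcl fun p => H p.1 p.2

/-! ### The knot event and its probability -/

theorem periodic_randomCurve {Ω : Type*} (ξ : Plane → Ω → Space) (ω : Ω) :
    Function.Periodic (randomCurve ξ ω) (2 * Real.pi) := fun t => by
  simp [randomCurve]

section

variable {Ω : Type*} [MeasurableSpace Ω] {P : Measure Ω} {ξ : Plane → Ω → Space}

theorem IsStationaryGaussianField.contDiff_randomCurve (hξ : IsStationaryGaussianField P ξ)
    (ω : Ω) : ContDiff ℝ 2 (randomCurve ξ ω) := by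
  refine (contDiff_infty.1 (hξ.smooth ω) 2).comp
    (f := fun t : ℝ => (!₂[Real.cos t, Real.sin t] : Plane)) ?_
  rw [contDiff_euclidean]
  intro i
  fin_cases i
  · exact Real.contDiff_cos
  · exact Real.contDiff_sin

theorem IsStationaryGaussianField.measurableSet_lipClose (hξ : IsStationaryGaussianField P ξ)
    (ε : ℝ) {g : ℝ → Space} (hg : Continuous g) :
    MeasurableSet {ω | LipClose ε (randomCurve ξ ω) g} := by
  have m : Measurable fun ω (i : Fin 3) t => randomCurve ξ ω t i :=
    measurable_pi_lambda _ hξ.measurable_coordCurve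
  convert m (measurableSet_lipCloseSet ε g) using 1
  ext ω
  exact (mem_lipCloseSet_iff hg (hξ.contDiff_randomCurve ω).continuous).symm

theorem IsStationaryGaussianField.measurableSet_sameKnotType
    (hξ : IsStationaryGaussianField P ξ) (f : ℝ → Space) :
    MeasurableSet {ω | SameKnotType (randomCurve ξ ω) f} := by
  have hst : ∀ ω ∈ {ω | SameKnotType (randomCurve ξ ω) f}, ∃ ε > 0, ∀ ω',
      LipClose ε (randomCurve ξ ω') (randomCurve ξ ω) → SameKnotType (randomCurve ξ ω') f := by
    rintro ω ⟨h1, h2, h3⟩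
    obtain ⟨ε, hε, H⟩ := h1.exists_stable
    refine ⟨ε, hε, fun ω' hω' => ?_⟩
    obtain ⟨h4, h5⟩ := H _ (hξ.contDiff_randomCurve ω') (periodic_randomCurve ξ ω') hω'
    exact ⟨h4, h2, h5.symm.trans h3⟩
  choose! ε hε H using hst
  obtain ⟨T, hTS, hT, hcover⟩ := exists_countable_lipClose
    (fun ω => (hξ.contDiff_randomCurve ω).of_le one_le_two) (periodic_randomCurve ξ) _ hε
  -- The radii come from stability, so every ball lies in the event; countably many of them cover
  -- it.
  have e : {ω | SameKnotType (randomCurve ξ ω) f} =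
      ⋃ ω' ∈ T, {ω | LipClose (ε ω') (randomCurve ξ ω) (randomCurve ξ ω')} := by
    ext ω
    simp only [Set.mem_iUnion]
    refine ⟨fun hω => ?_, fun ⟨ω', hω', h⟩ => H ω' (hTS hω') ω h⟩
    obtain ⟨ω', hω', h⟩ := hcover ω hω
    exact ⟨ω', hω', h⟩
  rw [e]
  exact MeasurableSet.biUnion hT fun ω' _ =>
    hξ.measurableSet_lipClose _ (hξ.contDiff_randomCurve ω').continuous

/-- The random curve has full support among closed curves, for the Lipschitz seminorm. -/
theorem IsStationaryGaussianField.pos_lipClose [IsProbabilityMeasure P]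
    (hξ : IsStationaryGaussianField P ξ) {f : ℝ → Space} (hf : ContDiff ℝ 1 f)
    (hper : Function.Periodic f (2 * Real.pi)) {ε : ℝ} (hε : 0 < ε) :
    0 < P {ω | LipClose ε (randomCurve ξ ω) f} := by
  have hγ : ∀ ω, ContDiff ℝ 1 (randomCurve ξ ω) := fun ω =>
    (hξ.contDiff_randomCurve ω).of_le one_le_two
  obtain ⟨T, -, hT, hcover⟩ := exists_countable_lipClose hγ (periodic_randomCurve ξ) Set.univ
    (ε := fun _ => ε / 2) fun _ _ => half_pos hε
  -- Countably many balls cover the whole probability space, so they cannot all be null.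
  obtain ⟨ω₀, hω₀⟩ : ∃ ω₀, 0 < P {ω | LipClose (ε / 2) (randomCurve ξ ω) (randomCurve ξ ω₀)} := by
    by_contra! h0
    have hnull : P (⋃ ω' ∈ T, {ω | LipClose (ε / 2) (randomCurve ξ ω) (randomCurve ξ ω')}) = 0 :=
      (measure_biUnion_null_iff hT).2 fun ω' _ => nonpos_iff_eq_zero.1 (h0 ω')
    have huniv : (⋃ ω' ∈ T, {ω | LipClose (ε / 2) (randomCurve ξ ω) (randomCurve ξ ω')}) =
        Set.univ := by
      refine Set.eq_univ_of_forall fun ω => ?_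
      obtain ⟨ω', hω', h⟩ := hcover ω trivial
      exact Set.mem_biUnion hω' h
    rw [huniv, measure_univ] at hnull
    exact one_ne_zero hnull
  set g := randomCurve ξ ω₀ with hg
  -- If `γ + p` is ε/2-close to `g`, then γ - f = (γ + p - g) + (g - f - p). Three coordinate errors
  -- of ε/6 bound the last term by ε/2.
  have hcoord : ∀ i : Fin 3, ∃ p ∈ circleExpSpan,
      ∀ s t, |(((g s - f s) i) - p s) - ((g t - f t) i - p t)| ≤ ε / 6 * |s - t| := fun i => by
    refine exists_mem_circleExpSpan_close (h := fun t => (g t - f t) i) ?_ (fun t => ?_)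
      (by positivity)
    · exact contDiff_euclidean.1 ((hγ ω₀).sub hf) i
    · simp only [hg, periodic_randomCurve ξ ω₀ t, hper t]
  choose p hp hpc using hcoord
  refine (pos_of_shift hξ hp (measurableSet_lipCloseSet (ε / 2) g) ?_).trans_le
    (measure_mono fun ω hω => ?_)
  · convert hω₀ using 3
    ext ω
    exact mem_lipCloseSet_iff (hγ ω₀).continuous (hγ ω).continuous
  · refine (mem_lipCloseSet_iff hf.continuous (hγ ω).continuous).1 fun s t => ?_
    have h1 := hω s t
    set v : Space := WithLp.toLp 2 fun i =>
      (((g s - f s) i) - p i s) - ((g t - f t) i - p i t) with hv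
    have hvn : ‖v‖ ≤ ε / 2 * |(s : ℝ) - t| := by
      have h2 : ‖v‖ ≤ ∑ i, ‖v i‖ := by
        have e : v = ∑ i, v i • EuclideanSpace.basisFun (Fin 3) ℝ i := by
          simpa using ((EuclideanSpace.basisFun (Fin 3) ℝ).sum_repr v).symm
        calc ‖v‖ = ‖∑ i, v i • EuclideanSpace.basisFun (Fin 3) ℝ i‖ := by rw [← e]
          _ ≤ ∑ i, ‖v i • EuclideanSpace.basisFun (Fin 3) ℝ i‖ := norm_sum_le _ _
          _ = ∑ i, ‖v i‖ := by simp [norm_smul]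
      refine h2.trans ?_
      calc ∑ i, ‖v i‖ ≤ ∑ _i : Fin 3, ε / 6 * |(s : ℝ) - t| :=
            Finset.sum_le_sum fun i _ => hpc i s t
        _ = ε / 2 * |(s : ℝ) - t| := by simp; ring
    refine le_trans ?_ ((norm_add_le _ _).trans (add_le_add h1 hvn)) |>.trans_eq ?_
    · refine le_of_eq ?_
      congr 1
      ext i
      simp [hv]
      ring
    · ring

end

theorem theorem2 {Ω : Type*} [MeasurableSpace Ω] (P : Measure Ω) [IsProbabilityMeasure P]
    (ξ : Plane → Ω → Space) (hξ : IsStationaryGaussianField P ξ)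
    (f : ℝ → Space) (hf : IsSmoothKnot f) :
    MeasurableSet {ω | SameKnotType (randomCurve ξ ω) f} ∧
      0 < P {ω | SameKnotType (randomCurve ξ ω) f} := by
  refine ⟨hξ.measurableSet_sameKnotType f, ?_⟩
  obtain ⟨ε, hε, H⟩ := hf.exists_stable
  refine (hξ.pos_lipClose (hf.contDiff.of_le one_le_two) hf.periodic hε).trans_le
    (measure_mono fun ω hω => ?_)
  obtain ⟨h1, h2⟩ := H _ (hξ.contDiff_randomCurve ω) (periodic_randomCurve ξ ω) hω
  exact ⟨h1, hf, h2.symm⟩
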